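/- Let $G$ be a finite group such that no section of $G$ (that is, no quotient $H/K$ with $K \trianglelefteq H \le G$) is isomorphic to the quaternion group $Q_8$ of order $8$. Suppose that every subgroup $H$ of $G$ of order $2$ is an $IC\Phi$-subgroup of $G$, i.e. $H \cap [H,G] \le \Phi(H)$, where $[H,G]$ is the subgroup generated by the commutators $[h,g]$ with $h \in H$, $g \in G$, and $\Phi(H)$ is the Frattini subgroup of $H$. Then $G$ is $2$-nilpotent, i.e. $G$ has a normal subgroup $N$ of odd order such that $G/N$ is a $2$-group. -/

import Mathlib

/-- The subgroup `H` of `G` is an `ICΦ`-subgroup of `G` if `H ∩ [H, G] ≤ Φ(H)`, where the Frattini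
subgroup `Φ(H)` of the group `H` is regarded as a subgroup of `G`. -/
def IsICPhiSubgroup {G : Type*} [Group G] (H : Subgroup G) : Prop :=
  H ⊓ ⁅H, (⊤ : Subgroup G)⁆ ≤ (frattini H).map H.subtype

/-- `G` is `Q₈`-free if no section `H ⧸ K` of `G` (with `K ⊴ H ≤ G`) is isomorphic to the quaternion
group `Q₈` of order `8`, which is `QuaternionGroup 2`. -/
def IsQ8Free (G : Type*) [Group G] : Prop :=
  ∀ (H : Subgroup G) (K : Subgroup H) [K.Normal], IsEmpty ((H ⧸ K) ≃* QuaternionGroup 2)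

/-- `G` is `p`-nilpotent if it has a normal `p`-complement: a normal `p'`-subgroup `N` such that
`G ⧸ N` is a `p`-group. -/
def IsPNilpotent (p : ℕ) (G : Type*) [Group G] : Prop :=
  ∃ (N : Subgroup G) (_ : N.Normal), p.Coprime (Nat.card N) ∧ IsPGroup p (G ⧸ N)

/-! ### Quaternion sections -/

/-! The argument is by induction on the order of `G`. An involution `t` generating an `ICΦ`-subgroup
lies outside `[⟨t⟩, G]`, and this condition passes to subgroups, as does being `Q₈`-free; so all
proper subgroups may be assumed `2`-nilpotent.

If every element of odd order normalizing a `2`-subgroup centralizes it, a Sylow `2`-subgroup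
controls its own fusion. By the focal subgroup theorem `G` then has a nontrivial `2`-quotient or odd
order, and induction finishes (`NormalizesPTrivially.isPNilpotent`).

Otherwise some `g` of odd order acts nontrivially on a `2`-subgroup `U`. Then `G = U⟨g⟩`, and
conjugation by `g` fixes every proper invariant subgroup of `U` pointwise. For a `Q₈`-free group
this forces `U` to be abelian (`FixesProperInvariant.commutator_eq_bot`), and all fixed points lie
in `U' = 1`. But for an involution `t` of `U`, the normal subgroup `[⟨t⟩, G]` meets `U` in a proper
invariant subgroup containing `t⁻¹ * σ t`; coprime action then makes `t` a fixed point, a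
contradiction. -/

lemma isQ8Free_iff {G : Type*} [Group G] :
    IsQ8Free G ↔ ∀ (H : Subgroup G) (f : H →* QuaternionGroup 2), ¬ Function.Surjective f := by
  constructor
  · intro h H f hf
    exact (h H f.ker).false (QuotientGroup.quotientKerEquivOfSurjective f hf)
  · intro h H K _
    refine ⟨fun e => h H (e.toMonoidHom.comp (QuotientGroup.mk' K)) ?_⟩
    exact e.surjective.comp (QuotientGroup.mk'_surjective K)

lemma IsQ8Free.of_injective {G H : Type*} [Group G] [Group H] (hG : IsQ8Free G) (i : H →* G)
    (hi : Function.Injective i) : IsQ8Free H := by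
  rw [isQ8Free_iff] at hG ⊢
  intro K f hf
  exact hG (K.map i) (f.comp (K.equivMapOfInjective i hi).symm.toMonoidHom)
    (hf.comp (K.equivMapOfInjective i hi).symm.surjective)

/-- A group with an embedded `Q₈` in one of its quotients is not `Q₈`-free. -/
lemma IsQ8Free.not_injective {G D : Type*} [Group G] [Group D] (hG : IsQ8Free G) (f : G →* D)
    (hf : Function.Surjective f) (j : QuaternionGroup 2 →* D) : ¬ Function.Injective j := by
  intro hj
  rw [isQ8Free_iff] at hG
  let e := MonoidHom.ofInjective hj
  refine hG (j.range.comap f) (e.symm.toMonoidHom.comp (f.subgroupComap j.range))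
    (e.symm.surjective.comp ?_)
  exact MonoidHom.subgroupComap_surjective_of_surjective f _ hf

/-- Two elements `u`, `v` satisfying the relations of `Q₈`, with `u ^ 2 ≠ 1`, generate a copy
of `Q₈`. -/
lemma exists_injective_quaternionGroup {D : Type*} [Group D] {u v : D} (h4 : u ^ 4 = 1)
    (h2 : u ^ 2 ≠ 1) (hv : v ^ 2 = u ^ 2) (huv : u * v = v * u⁻¹) :
    ∃ j : QuaternionGroup 2 →* D, Function.Injective j := by
  let e : ZMod (2 * 2) → D := fun i => u ^ i.val
  have e_add : ∀ i j, e (i + j) = e i * e j := by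
    intro i j
    simp only [e]
    rw [← pow_add, ZMod.val_add]
    exact (pow_eq_pow_mod (i.val + j.val) h4).symm
  have e_zero : e 0 = 1 := by simp [e]
  have e_neg : ∀ i, e (-i) = (e i)⁻¹ := by
    intro i
    rw [eq_inv_iff_mul_eq_one, ← e_add, neg_add_cancel, e_zero]
  have e_sub : ∀ i j, e (i - j) = e i * (e j)⁻¹ := by
    intro i j
    rw [sub_eq_add_neg, e_add, e_neg]
  have e_comm : ∀ i j, e i * e j = e j * e i := by
    intro i j
    rw [← e_add, add_comm, e_add]
  have e_v : ∀ i, e i * v = v * (e i)⁻¹ := by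
    intro i
    have h : SemiconjBy v u⁻¹ u := huv.symm
    have := (h.pow_right i.val).eq
    simp only [e]
    rw [← inv_pow]
    exact this.symm
  have e_two : e 2 = v ^ 2 := by rw [hv]; rfl
  let j : QuaternionGroup 2 →* D := MonoidHom.mk'
    (fun g => match g with
      | .a i => e i
      | .xa i => v * e i) <| by
    rintro (i | i) (k | k)
    · exact e_add i k
    · change v * e (k - i) = e i * (v * e k)
      rw [← mul_assoc, e_v, e_sub, mul_assoc, ← e_neg, e_comm]
    · change v * e (i + k) = v * e i * e k
      rw [e_add, mul_assoc]
    · change e (2 + k - i) = v * e i * (v * e k)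
      rw [mul_assoc, ← mul_assoc (e i), e_v, e_sub, e_add, e_two, sq, ← e_neg, mul_assoc,
        mul_assoc, mul_assoc, e_comm]
  refine ⟨j, ?_⟩
  have hz : ∀ i, e i = 1 → i = 0 := by
    intro i hi
    have h1 : u ≠ 1 := by rintro rfl; simp at h2
    have h3 : u ^ 3 ≠ 1 := by
      intro h3
      rw [pow_succ, h3, one_mul] at h4
      exact h1 h4
    change u ^ i.val = 1 at hi
    have : i.val = 0 := by
      rcases i with ⟨i, hi'⟩
      change u ^ i = 1 at hi
      change i = 0
      have : i < 4 := hi'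
      interval_cases i
      · rfl
      · simp at hi; exact absurd hi h1
      · exact absurd hi h2
      · exact absurd hi h3
    exact (ZMod.val_eq_zero i).1 this
  rw [injective_iff_map_eq_one]
  rintro (i | i) hi
  · change e i = 1 at hi
    rw [hz i hi]
    rfl
  · change v * e i = 1 at hi
    exfalso
    -- Here `v` would be a power of `u`, so it would commute with `u`, giving `u = u⁻¹`.
    have hv' : v = e (-i) := by rw [e_neg, eq_inv_iff_mul_eq_one, hi]
    have h1 : u * v = v * u := by
      have : u = e 1 := by change u = u ^ 1; simp
      rw [hv', this, e_comm]
    rw [h1] at huv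
    have := mul_left_cancel huv
    apply h2
    rw [sq]
    nth_rw 1 [this]
    simp

/-! ### Automorphisms of `p`-groups acting trivially on all proper invariant subgroups -/

section Automorphism

variable {P : Type*} [Group P] {p : ℕ}

/-- If `σ` has order prime to `p` on a `p`-group and fixes `x⁻¹ * σ x`, then it fixes `x`. -/
lemma IsPGroup.apply_eq_of_apply_inv_mul (hP : IsPGroup p P) {σ : MulAut P}
    (hσ : p.Coprime (orderOf σ)) {x : P} (hx : σ (x⁻¹ * σ x) = x⁻¹ * σ x) : σ x = x := by
  set r := x⁻¹ * σ x with hr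
  have hσx : σ x = x * r := by rw [hr]; group
  have hpow : ∀ k : ℕ, (σ ^ k) x = x * r ^ k := by
    intro k
    induction k with
    | zero => simp
    | succ k ih => rw [pow_succ', MulAut.mul_apply, ih, map_mul, map_pow, hx, hσx, pow_succ',
        mul_assoc]
  have h1 : r ^ orderOf σ = 1 := by
    have := hpow (orderOf σ)
    rw [pow_orderOf_eq_one] at this
    simpa using this.symm
  obtain ⟨k, hk⟩ := hP r
  have : r = 1 := by
    have h2 := Nat.dvd_gcd (orderOf_dvd_of_pow_eq_one hk) (orderOf_dvd_of_pow_eq_one h1)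
    rw [(Nat.Coprime.pow_left k hσ).gcd_eq_one, Nat.dvd_one, orderOf_eq_one_iff] at h2
    exact h2
  rw [hσx, this, mul_one]

/-- The automorphism `σ` fixes every proper `σ`-invariant subgroup pointwise. -/
def FixesProperInvariant (σ : MulAut P) : Prop :=
  ∀ R : Subgroup P, (∀ x ∈ R, σ x ∈ R) → R ≠ ⊤ → ∀ x ∈ R, σ x = x

/-- The subgroup `[P, σ]` is invariant. Were it proper, `σ` would fix every `x⁻¹ * σ x`, hence every
`x` by coprimality. -/
lemma FixesProperInvariant.closure_eq_top {σ : MulAut P} (h : FixesProperInvariant σ)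
    (hP : IsPGroup p P) (hσ : p.Coprime (orderOf σ)) (hne : σ ≠ 1) :
    Subgroup.closure (Set.range fun x => x⁻¹ * σ x) = ⊤ := by
  by_contra hR
  apply hne
  ext x
  refine hP.apply_eq_of_apply_inv_mul hσ (h _ ?_ hR _ (Subgroup.subset_closure ⟨x, rfl⟩))
  intro y hy
  have hy' : y⁻¹ * σ y ∈ Subgroup.closure (Set.range fun x => x⁻¹ * σ x) :=
    Subgroup.subset_closure ⟨y, rfl⟩
  simpa using mul_mem hy hy'

/-- Since `[P, σ] = P`, the endomorphism `y ↦ y⁻¹ * σ y` of the finite group `P / P'` is onto, hence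
injective, so `σ` has no nontrivial fixed point there. -/
lemma FixesProperInvariant.mem_commutator [Finite P] {σ : MulAut P} (h : FixesProperInvariant σ)
    (hP : IsPGroup p P) (hσ : p.Coprime (orderOf σ)) (hne : σ ≠ 1) {x : P} (hx : σ x = x) :
    x ∈ commutator P := by
  let τ : Abelianization P →* Abelianization P := Abelianization.map σ.toMonoidHom
  let δ : Abelianization P →* Abelianization P := (MonoidHom.id _)⁻¹ * τ
  have hδ : ∀ y : P, δ (Abelianization.of y) = Abelianization.of (y⁻¹ * σ y) := fun y => by
    simp [δ, τ]
  have hsurj : Function.Surjective δ := by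
    have hle : Subgroup.closure (Set.range fun x => x⁻¹ * σ x) ≤
        δ.range.comap Abelianization.of := by
      rw [Subgroup.closure_le]
      rintro _ ⟨y, rfl⟩
      exact ⟨Abelianization.of y, hδ y⟩
    rw [h.closure_eq_top hP hσ hne] at hle
    intro y
    obtain ⟨y, rfl⟩ := QuotientGroup.mk_surjective y
    exact hle (Subgroup.mem_top y)
  have hinj := Finite.injective_iff_surjective.2 hsurj
  have : Abelianization.of x = 1 := hinj (by rw [hδ, hx, map_one]; simp)
  rwa [← Abelianization.ker_of, MonoidHom.mem_ker]

/-- In a nontrivial finite `2`-group the squares generate a proper subgroup. -/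
lemma IsPGroup.closure_sq_ne_top [Finite P] [Nontrivial P] (hP : IsPGroup 2 P) :
    Subgroup.closure (Set.range fun x : P => x ^ 2) ≠ ⊤ := by
  have : Fact (Nat.Prime 2) := ⟨Nat.prime_two⟩
  intro htop
  have hnil : Group.IsNilpotent P := hP.isNilpotent
  have hlt : commutator P < ⊤ := Group.IsSolvable.commutator_lt_top_of_nontrivial P
  let s : Abelianization P →* Abelianization P := powMonoidHom 2
  have hsurj : Function.Surjective s := by
    have hle : Subgroup.closure (Set.range fun x : P => x ^ 2) ≤
        s.range.comap Abelianization.of := by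
      rw [Subgroup.closure_le]
      rintro _ ⟨y, rfl⟩
      exact ⟨Abelianization.of y, by simp [s]⟩
    rw [htop] at hle
    intro y
    obtain ⟨y, rfl⟩ := QuotientGroup.mk_surjective y
    exact hle (Subgroup.mem_top y)
  have hinj := Finite.injective_iff_surjective.2 hsurj
  apply hlt.ne
  rw [eq_top_iff]
  intro x _
  obtain ⟨k, hk⟩ := hP x
  have hof : ∀ k : ℕ, (Abelianization.of x) ^ 2 ^ k = 1 → Abelianization.of x = 1 := by
    intro k
    induction k with
    | zero => simp
    | succ k ih =>
      intro hk
      apply ih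
      apply hinj
      simpa [s, pow_succ, pow_mul] using hk
  have := hof k (by rw [← map_pow, hk, map_one])
  rwa [← Abelianization.ker_of, MonoidHom.mem_ker]

end Automorphism

section Automorphism

open scoped commutatorElement

variable {P : Type*} [Group P]

/-- A nontrivial automorphism of odd order of a `Q₈`-free `2`-group that fixes all proper invariant
subgroups pointwise exists only on abelian groups. -/
lemma FixesProperInvariant.commutator_eq_bot [Finite P] {σ : MulAut P}
    (h : FixesProperInvariant σ) (hP : IsPGroup 2 P) (hσ : Nat.Coprime 2 (orderOf σ)) (hne : σ ≠ 1)
    (hQ : IsQ8Free P) : commutator P = ⊥ := by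
  have : Fact (Nat.Prime 2) := ⟨Nat.prime_two⟩
  have hnt : Nontrivial P := by
    by_contra hn
    rw [not_nontrivial_iff_subsingleton] at hn
    exact hne (by ext x; exact Subsingleton.elim _ _)
  have hnil : Group.IsNilpotent P := hP.isNilpotent
  have hlt : commutator P < ⊤ := Group.IsSolvable.commutator_lt_top_of_nontrivial P
  have hfix : ∀ x ∈ commutator P, σ x = x := by
    refine h _ (fun x hx => ?_) hlt.ne
    have := (Subgroup.characteristic_iff_map_eq.1 (inferInstance : (commutator P).Characteristic)) σ
    rw [← this]
    exact Subgroup.mem_map_of_mem _ hx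
  have hcomm : ∀ x y : P, ⁅x, y⁆ ∈ commutator P := fun x y =>
    Subgroup.commutator_mem_commutator (Subgroup.mem_top x) (Subgroup.mem_top y)
  -- Fixed points are central: `σ` fixes `⁅c, y⁆`, so `c` commutes with each `y⁻¹ * σ y`, and these
  -- generate `P`.
  have hcent : ∀ c, σ c = c → ∀ x, Commute c x := by
    intro c hc x
    have hle : Subgroup.closure (Set.range fun x => x⁻¹ * σ x) ≤ Subgroup.centralizer {c} := by
      rw [Subgroup.closure_le]
      rintro _ ⟨y, rfl⟩
      have h1 := hfix _ (hcomm c y)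
      rw [map_commutatorElement, hc, commutatorElement_def, commutatorElement_def] at h1
      simp only [SetLike.mem_coe, Subgroup.mem_centralizer_singleton_iff]
      have h2 : σ y * c⁻¹ * (σ y)⁻¹ = y * c⁻¹ * y⁻¹ := by
        simp only [mul_assoc] at h1 ⊢
        exact mul_left_cancel h1
      have h3 : σ y * c * (σ y)⁻¹ = y * c * y⁻¹ := by
        have := congrArg (·⁻¹) h2
        simpa [mul_assoc] using this
      symm
      calc c * (y⁻¹ * σ y) = y⁻¹ * (y * c * y⁻¹) * σ y := by group
        _ = y⁻¹ * (σ y * c * (σ y)⁻¹) * σ y := by rw [h3]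
        _ = y⁻¹ * σ y * c := by group
    rw [h.closure_eq_top hP hσ hne] at hle
    exact Subgroup.mem_centralizer_iff.1 (hle (Subgroup.mem_top x)) c rfl
  have hsqfix : ∀ x : P, σ (x ^ 2) = x ^ 2 := by
    intro x
    refine h _ (fun y hy => ?_) hP.closure_sq_ne_top _ (Subgroup.subset_closure ⟨x, rfl⟩)
    have hle : Subgroup.closure (Set.range fun x : P => x ^ 2) ≤
        (Subgroup.closure (Set.range fun x : P => x ^ 2)).comap σ.toMonoidHom := by
      rw [Subgroup.closure_le]
      rintro _ ⟨z, rfl⟩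
      exact Subgroup.subset_closure ⟨σ z, by simp⟩
    exact hle hy
  have hsqmem : ∀ x : P, x ^ 2 ∈ commutator P := fun x => h.mem_commutator hP hσ hne (hsqfix x)
  have hCcent : ∀ c ∈ commutator P, ∀ x, Commute c x := fun c hc => hcent c (hfix c hc)
  -- `⁅x, y⁆ ^ 2 = ⁅x ^ 2, y⁆ = 1`, because commutators and squares are central.
  have hCsq : ∀ c ∈ commutator P, c ^ 2 = 1 := by
    intro c hc
    rw [commutator_eq_closure] at hc
    induction hc using Subgroup.closure_induction with
    | mem c hc =>
      obtain ⟨x, y, rfl⟩ := hc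
      have h1 : x * y = ⁅x, y⁆ * (y * x) := by rw [commutatorElement_def]; group
      have h2 := (hCcent _ (hcomm x y) x).eq
      have h3 : x ^ 2 * y = ⁅x, y⁆ ^ 2 * (y * x ^ 2) := by
        calc x ^ 2 * y = x * (x * y) := by rw [sq, mul_assoc]
          _ = (x * ⁅x, y⁆) * (y * x) := by rw [h1, mul_assoc]
          _ = ⁅x, y⁆ * (x * y) * x := by rw [← h2]; simp only [mul_assoc]
          _ = ⁅x, y⁆ * (⁅x, y⁆ * (y * x)) * x := by rw [← h1]
          _ = ⁅x, y⁆ ^ 2 * (y * x ^ 2) := by simp only [sq, mul_assoc]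
      rw [(hCcent _ (hsqmem x) y).eq] at h3
      exact (mul_eq_right.1 h3.symm)
    | one => simp
    | mul x y hx hy ihx ihy =>
      rw [← commutator_eq_closure] at hx
      rw [(hCcent x hx y).mul_pow, ihx, ihy, one_mul]
    | inv x _ ih => rw [inv_pow, ih, inv_one]
  by_contra hbot
  obtain ⟨a, b, hab⟩ : ∃ a b : P, ⁅a, b⁆ ≠ 1 := by
    by_contra! hall
    apply hbot
    rw [commutator_eq_closure, Subgroup.closure_eq_bot_iff]
    rintro _ ⟨a, b, rfl⟩
    exact hall a b
  set z := ⁅a, b⁆ with hz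
  have hzC : z ∈ commutator P := hcomm a b
  -- Maximality makes `P' / M` of order `2`, generated by the image of `z`.
  obtain ⟨M, hM⟩ : ∃ M : Subgroup P, Maximal (fun M => M ≤ commutator P ∧ z ∉ M) M :=
    (Set.toFinite {M : Subgroup P | M ≤ commutator P ∧ z ∉ M}).exists_maximal
      ⟨⊥, bot_le, by simpa using hab⟩
  obtain ⟨⟨hMC, hzM⟩, hmax⟩ := hM
  have hMn : M.Normal := ⟨fun m hm g => by
    rw [← (hCcent m (hMC hm) g).eq, mul_inv_cancel_right]; exact hm⟩
  have hdich : ∀ c ∈ commutator P, c ∉ M → z⁻¹ * c ∈ M := by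
    intro c hc hcM
    have hz' : z ∈ M ⊔ Subgroup.zpowers c := by
      by_contra hz'
      have hle : M ⊔ Subgroup.zpowers c ≤ commutator P :=
        sup_le hMC (by rwa [Subgroup.zpowers_le])
      exact hcM (hmax ⟨hle, hz'⟩ le_sup_left
        (Subgroup.mem_sup_right (Subgroup.mem_zpowers c)))
    rw [Subgroup.mem_sup_of_normal_left] at hz'
    obtain ⟨m, hm, _, ⟨k, rfl⟩, hmk⟩ := hz'
    simp only at hmk
    have hc2 : c ^ (2 : ℤ) = 1 := by exact_mod_cast hCsq c hc
    rcases Int.even_or_odd' k with ⟨l, rfl | rfl⟩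
    · rw [zpow_mul, hc2, one_zpow, mul_one] at hmk
      exact absurd (hmk ▸ hm) hzM
    · rw [zpow_add, zpow_mul, hc2, one_zpow, one_mul, zpow_one] at hmk
      rw [← hmk, mul_inv_rev, (hCcent c hc m⁻¹).inv_left.eq, inv_mul_cancel_right]
      exact inv_mem hm
  let π := QuotientGroup.mk' M
  have hπ : ∀ c ∈ commutator P, π c = 1 ∨ π c = π z := by
    intro c hc
    by_cases hcM : c ∈ M
    · exact Or.inl ((QuotientGroup.eq_one_iff c).2 hcM)
    · exact Or.inr (QuotientGroup.eq.2 (hdich c hc hcM)).symm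
  have hπz : π z ≠ 1 := fun h1 => hzM ((QuotientGroup.eq_one_iff z).1 h1)
  have hπz2 : π z ^ 2 = 1 := by rw [← map_pow, hCsq z hzC, map_one]
  have hab' : ¬ Commute (π a) (π b) := by
    rw [← commutatorElement_eq_one_iff_commute, ← map_commutatorElement]
    exact hπz
  -- Two elements of `S` with noncommuting images would have squares and commutator all equal to `π
  -- z`, and so generate a `Q₈` in `P / M`.
  let S : Set P := {x | π (x ^ 2) = π z}
  have hScomm : ∀ u ∈ S, ∀ v ∈ S, Commute (π u) (π v) := by
    intro u hu v hv
    change π (u ^ 2) = π z at hu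
    change π (v ^ 2) = π z at hv
    rw [map_pow] at hu hv
    by_contra hc
    rw [← commutatorElement_eq_one_iff_commute, ← map_commutatorElement] at hc
    have huv := (hπ _ (hcomm u v)).resolve_left hc
    rw [← hu, map_commutatorElement, commutatorElement_def] at huv
    have h1 : π v * (π u)⁻¹ = π u * π v := by
      calc π v * (π u)⁻¹ = (π u)⁻¹ * (π u * π v * (π u)⁻¹ * (π v)⁻¹) * π v := by group
        _ = π u * π v := by rw [huv]; group
    obtain ⟨j, hj⟩ := exists_injective_quaternionGroup (u := π u) (v := π v)
      (by rw [show 4 = 2 * 2 from rfl, pow_mul, hu, hπz2]) (by rw [hu]; exact hπz)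
      (by rw [hu, hv]) h1.symm
    exact hQ.not_injective π (QuotientGroup.mk'_surjective M) j hj
  -- If `S` generates `P`, then `P / M` is abelian. If not, `σ` fixes `S` pointwise, so `S ⊆ P'` has
  -- trivial squares and must be empty; then `P / M` has exponent `2`. Either way `π a` and `π b`
  -- commute.
  by_cases hS : Subgroup.closure S = ⊤
  · apply hab'
    have hle : ∀ T : Set P, (∀ u ∈ S, ∀ v ∈ T, Commute (π u) (π v)) →
        ∀ x, ∀ v ∈ T, Commute (π x) (π v) := by
      intro T hT x v hv
      have : x ∈ Subgroup.closure S := hS ▸ Subgroup.mem_top x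
      induction this using Subgroup.closure_induction with
      | mem x hx => exact hT x hx v hv
      | one => simp
      | mul x y _ _ hx hy => rw [map_mul]; exact hx.mul_left hy
      | inv x _ hx => rw [map_inv]; exact hx.inv_left
    have h1 := hle S hScomm
    exact hle Set.univ (fun u hu v _ => (h1 v u hu).symm) a b (Set.mem_univ b)
  · have hSfix := h (Subgroup.closure S) (fun x hx => by
      have hle : Subgroup.closure S ≤ (Subgroup.closure S).comap σ.toMonoidHom := by
        rw [Subgroup.closure_le]
        intro y hy
        refine Subgroup.subset_closure ?_
        change π ((σ y) ^ 2) = π z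
        rw [← map_pow, hsqfix y]
        exact hy
      exact hle hx) hS
    have hsq1 : ∀ x : P, π x ^ 2 = 1 := by
      intro x
      rw [← map_pow]
      refine (hπ _ (hsqmem x)).resolve_right fun hx => hπz ?_
      have hxS : x ∈ S := hx
      rw [← hx, hCsq x (h.mem_commutator hP hσ hne (hSfix x (Subgroup.subset_closure hxS))),
        map_one]
    apply hab'
    have h1 := hsq1 (a * b)
    rw [map_mul] at h1
    have hinv : ∀ x : P, (π x)⁻¹ = π x := fun x =>
      inv_eq_of_mul_eq_one_left (by rw [← sq, hsq1])
    have h2 : (π a * π b)⁻¹ = π a * π b := inv_eq_of_mul_eq_one_left (by rw [← sq, h1])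
    rw [mul_inv_rev, hinv, hinv] at h2
    exact h2.symm

end Automorphism

/-! ### `p`-nilpotency -/

section PNilpotent

variable {G : Type*} [Group G] {p : ℕ}

/-- Elements whose orders divide a power of `p` and are prime to `p` are trivial. -/
lemma eq_one_of_pow_of_coprime {x : G} {k : ℕ} (h : x ^ p ^ k = 1) (hx : p.Coprime (orderOf x)) :
    x = 1 := by
  rw [← orderOf_eq_one_iff]
  exact Nat.Coprime.eq_one_of_dvd (hx.symm.pow_right k) (orderOf_dvd_of_pow_eq_one h)

/-- In a `p`-nilpotent group the `p'`-elements normalizing a `p`-subgroup centralize it. -/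
lemma IsPNilpotent.commute_of_normalizes [Finite G] (hG : IsPNilpotent p G) {R : Subgroup G}
    (hR : IsPGroup p R) {g : G} (hg : p.Coprime (orderOf g)) (hgR : ∀ r ∈ R, g * r * g⁻¹ ∈ R)
    {r : G} (hr : r ∈ R) : g * r = r * g := by
  obtain ⟨K, hK, hcop, hquot⟩ := hG
  have hgK : g ∈ K := by
    rw [← QuotientGroup.eq_one_iff]
    obtain ⟨k, hk⟩ := hquot (g : G ⧸ K)
    refine eq_one_of_pow_of_coprime hk (hg.coprime_dvd_right ?_)
    exact orderOf_map_dvd (QuotientGroup.mk' K) g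
  have h1 : g * r * g⁻¹ * r⁻¹ ∈ R := mul_mem (hgR r hr) (inv_mem hr)
  have h2 : g * r * g⁻¹ * r⁻¹ ∈ K := by
    have := mul_mem hgK (hK.conj_mem _ (inv_mem hgK) r)
    simpa only [mul_assoc] using this
  -- The commutator of `g` and `r` lies in the `p`-group `R` and in the `p'`-group `K`.
  obtain ⟨k, hk⟩ := hR ⟨_, h1⟩
  have h3 : g * r * g⁻¹ * r⁻¹ = 1 := by
    refine eq_one_of_pow_of_coprime (k := k) (p := p) (by simpa using congrArg Subtype.val hk) ?_
    exact hcop.coprime_dvd_right (Subgroup.orderOf_dvd_natCard K h2)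
  rwa [mul_inv_eq_one, mul_inv_eq_iff_eq_mul] at h3

/-- The same statement for a `p`-nilpotent subgroup containing the given data. -/
lemma commute_of_normalizes_of_isPNilpotent_subgroup [Finite G] {H : Subgroup G}
    (hH : IsPNilpotent p H) {R : Subgroup G} (hR : IsPGroup p R) (hRH : R ≤ H) {g : G}
    (hgH : g ∈ H) (hg : p.Coprime (orderOf g)) (hgR : ∀ r ∈ R, g * r * g⁻¹ ∈ R)
    {r : G} (hr : r ∈ R) : g * r = r * g := by
  have hR' : IsPGroup p (R.subgroupOf H) :=
    hR.of_equiv (Subgroup.subgroupOfEquivOfLe hRH).symm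
  have := hH.commute_of_normalizes hR' (g := ⟨g, hgH⟩) (by rwa [Subgroup.orderOf_mk])
    (fun r hr => hgR r hr) (r := ⟨r, hRH hr⟩) hr
  exact congrArg Subtype.val this

/-- A group with a `p`-nilpotent normal subgroup of `p`-power index is `p`-nilpotent. -/
lemma IsPNilpotent.of_normal [Finite G] {K : Subgroup G} [K.Normal] (hK : IsPNilpotent p K)
    (hGK : IsPGroup p (G ⧸ K)) : IsPNilpotent p G := by
  obtain ⟨M, hM, hcop, hquot⟩ := hK
  -- `M` is exactly the set of `p'`-elements of `K`, so it is invariant under conjugation by `G`.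
  have hMmem : ∀ x : K, x ∈ M ↔ p.Coprime (orderOf x) := by
    intro x
    refine ⟨fun hx => hcop.coprime_dvd_right (Subgroup.orderOf_dvd_natCard M hx), fun hx => ?_⟩
    rw [← QuotientGroup.eq_one_iff]
    obtain ⟨k, hk⟩ := hquot (x : K ⧸ M)
    exact eq_one_of_pow_of_coprime hk
      (hx.coprime_dvd_right (orderOf_map_dvd (QuotientGroup.mk' M) x))
  have hn : (M.map K.subtype).Normal := by
    refine ⟨?_⟩
    rintro _ ⟨x, hx, rfl⟩ g
    refine ⟨MulAut.conjNormal g x, ?_, by simp⟩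
    have hx' := (hMmem x).1 hx
    refine (hMmem _).2 ?_
    rwa [MulEquiv.orderOf_eq]
  refine ⟨M.map K.subtype, hn, ?_, ?_⟩
  · rwa [Subgroup.card_map_of_injective K.subtype_injective]
  · intro g
    obtain ⟨g, rfl⟩ := QuotientGroup.mk_surjective g
    obtain ⟨k, hk⟩ := hGK (g : G ⧸ K)
    rw [← QuotientGroup.mk_pow, QuotientGroup.eq_one_iff] at hk
    obtain ⟨l, hl⟩ := hquot ((⟨g ^ p ^ k, hk⟩ : K) : K ⧸ M)
    rw [← QuotientGroup.mk_pow, QuotientGroup.eq_one_iff] at hl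
    refine ⟨k + l, ?_⟩
    rw [← QuotientGroup.mk_pow, QuotientGroup.eq_one_iff]
    refine ⟨_, hl, ?_⟩
    simp [pow_add, pow_mul]

end PNilpotent

/-! ### Groups whose `p`-local subgroups act on `p`-subgroups as `p`-groups -/

section Frobenius

open scoped Pointwise commutatorElement

variable {G : Type*} [Group G] {p : ℕ}

/-- Every `p'`-element normalizing a `p`-subgroup centralizes it. -/
def NormalizesPTrivially (p : ℕ) (G : Type*) [Group G] : Prop :=
  ∀ U : Subgroup G, IsPGroup p U → ∀ g ∈ Subgroup.normalizer (U : Set G), p.Coprime (orderOf g) →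
    g ∈ Subgroup.centralizer (U : Set G)

/-- The quotient `N(U) / C(U)` is a `p`-group, so a Sylow `p`-subgroup of `N(U)` maps onto it. -/
lemma NormalizesPTrivially.exists_mul [Finite G] [Fact p.Prime] (h : NormalizesPTrivially p G)
    {U : Subgroup G} (hU : IsPGroup p U) (S : Sylow p (Subgroup.normalizer (U : Set G)))
    (n : Subgroup.normalizer (U : Set G)) :
    ∃ s ∈ S, (n * (s : G)⁻¹ : G) ∈ Subgroup.centralizer (U : Set G) := by
  let N := Subgroup.normalizer (U : Set G)
  let C : Subgroup N := (Subgroup.centralizer (U : Set G)).subgroupOf N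
  have hC : C.Normal := by
    refine ⟨fun c hc g => ?_⟩
    rw [Subgroup.mem_subgroupOf, Subgroup.mem_centralizer_iff] at hc ⊢
    intro u hu
    have h1 := hc _ ((Subgroup.mem_normalizer_iff''.1 g.2 u).1 hu)
    push_cast
    calc u * (g * c * (g : G)⁻¹) = g * ((g : G)⁻¹ * u * g * c) * (g : G)⁻¹ := by group
      _ = g * (c * ((g : G)⁻¹ * u * g)) * (g : G)⁻¹ := by rw [h1]
      _ = g * c * (g : G)⁻¹ * u := by group
  have hNC : IsPGroup p (N ⧸ C) := by
    intro g
    obtain ⟨g, rfl⟩ := QuotientGroup.mk_surjective g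
    obtain ⟨k, m, hm, hkm⟩ := Nat.exists_eq_pow_mul_and_not_dvd (orderOf_pos g).ne' p
      (Fact.out : p.Prime).ne_one
    refine ⟨k, ?_⟩
    rw [← QuotientGroup.mk_pow, QuotientGroup.eq_one_iff]
    refine h U hU _ (g ^ p ^ k).2 ?_
    change p.Coprime (orderOf ((g ^ p ^ k : N) : G))
    rw [Subgroup.orderOf_coe, orderOf_pow_of_dvd (pow_ne_zero _ (Fact.out : p.Prime).ne_zero)
      (hkm ▸ dvd_mul_right _ _), hkm,
      Nat.mul_div_cancel_left _ (pow_pos (Fact.out : p.Prime).pos _)]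
    exact ((Fact.out : p.Prime).coprime_iff_not_dvd).2 hm
  let T := S.mapSurjective (QuotientGroup.mk'_surjective C)
  have hT : (T : Subgroup (N ⧸ C)) = ⊤ :=
    (T.is_maximal' (hNC.to_subgroup ⊤) le_top).symm
  have hn : (n : N ⧸ C) ∈ (T : Subgroup (N ⧸ C)) := hT ▸ Subgroup.mem_top _
  obtain ⟨s, hs, hsn⟩ := hn
  refine ⟨s, hs, ?_⟩
  have h1 : QuotientGroup.mk' C (n * s⁻¹) = 1 := by
    rw [map_mul, map_inv, hsn]
    exact mul_inv_cancel _
  exact (QuotientGroup.eq_one_iff (n * s⁻¹)).1 h1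

lemma IsPGroup.exists_mem_normalizer_notMem [Finite G] [Fact p.Prime] {D P : Subgroup G}
    (hP : IsPGroup p P) (hDP : D < P) :
    ∃ x ∈ P, x ∈ Subgroup.normalizer (D : Set G) ∧ x ∉ D := by
  have hnil : Group.IsNilpotent P := hP.isNilpotent
  have hlt : D.subgroupOf P < ⊤ := by
    rw [lt_top_iff_ne_top, Ne, Subgroup.subgroupOf_eq_top]
    exact not_le_of_gt hDP
  obtain ⟨x, hx, hxD⟩ := SetLike.exists_of_lt
    (Group.normalizerCondition_of_isNilpotent (D.subgroupOf P) hlt)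
  refine ⟨x, x.2, ?_, hxD⟩
  apply Subgroup.mem_normalizer_fintype
  intro d hd
  exact (Subgroup.mem_normalizer_iff.1 hx ⟨d, hDP.le hd⟩).1 hd

/-- Downward induction on the order of `D = P ⊓ Q`. Sylow subgroups of `N(D)` containing `P ⊓ N(D)`
and `Q ⊓ N(D)` are conjugate by an element of `C(D)`. As normalizers grow, extending to Sylow
subgroups of `G` yields `R` and `c • R` meeting `P` and `Q` in more than `D`. -/
lemma NormalizesPTrivially.exists_centralizer_smul_eq [Finite G] [Fact p.Prime]
    (h : NormalizesPTrivially p G) (P Q : Sylow p G) :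
    ∃ c ∈ Subgroup.centralizer ((P ⊓ Q : Subgroup G) : Set G), c • P = Q := by
  induction hn : Nat.card G - Nat.card (P ⊓ Q : Subgroup G) using Nat.strong_induction_on
    generalizing P Q with
  | _ n ih =>
  subst hn
  by_cases hPQ : P = Q
  · exact ⟨1, one_mem _, by rw [one_smul, hPQ]⟩
  set D : Subgroup G := P ⊓ Q with hD
  have hDP : D < P := lt_of_le_of_ne inf_le_left fun heq =>
    hPQ (Sylow.ext (P.is_maximal' Q.2 (inf_eq_left.1 heq)).symm)
  have hDQ : D < Q := lt_of_le_of_ne inf_le_right fun heq =>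
    hPQ (Sylow.ext (Q.is_maximal' P.2 (inf_eq_right.1 heq)))
  have hDp : IsPGroup p D := P.2.to_le hDP.le
  set N := Subgroup.normalizer (D : Set G) with hN
  have hDN : D ≤ N := Subgroup.le_normalizer
  have grow : ∀ A B : Sylow p G, D < A → (A ⊓ N : Subgroup G) ≤ B →
      D ≤ (A ⊓ B : Subgroup G) ∧ Nat.card G - Nat.card (A ⊓ B : Subgroup G) <
        Nat.card G - Nat.card D := by
    intro A B hA hB
    have hle : D ≤ (A ⊓ B : Subgroup G) := le_inf hA.le ((le_inf hA.le hDN).trans hB)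
    refine ⟨hle, ?_⟩
    obtain ⟨x, hxA, hxN, hxD⟩ := A.2.exists_mem_normalizer_notMem hA
    have hlt : D < (A ⊓ B : Subgroup G) :=
      lt_of_le_of_ne hle fun heq => hxD (heq ▸ ⟨hxA, hB ⟨hxA, hxN⟩⟩)
    have h1 := Set.ncard_lt_ncard (SetLike.coe_ssubset_coe.2 hlt) (Set.toFinite _)
    have h2 := Subgroup.card_le_card_group (A ⊓ B : Subgroup G)
    rw [← Nat.card_coe_set_eq, ← Nat.card_coe_set_eq] at h1
    simp only [SetLike.coe_sort_coe] at h1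
    omega
  obtain ⟨S, hS⟩ := (P.2.of_injective (Subgroup.inclusion inf_le_left : (P ⊓ N : Subgroup G) →* P)
    (Subgroup.inclusion_injective _)).of_equiv
    (Subgroup.subgroupOfEquivOfLe (inf_le_right : (P ⊓ N : Subgroup G) ≤ N)).symm
    |>.exists_le_sylow
  obtain ⟨T, hT⟩ := (Q.2.of_injective (Subgroup.inclusion inf_le_left : (Q ⊓ N : Subgroup G) →* Q)
    (Subgroup.inclusion_injective _)).of_equiv
    (Subgroup.subgroupOfEquivOfLe (inf_le_right : (Q ⊓ N : Subgroup G) ≤ N)).symm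
    |>.exists_le_sylow
  obtain ⟨R, hR⟩ := (S.2.map N.subtype).exists_le_sylow
  obtain ⟨n, rfl⟩ := MulAction.exists_smul_eq N S T
  obtain ⟨s, hs, hc⟩ := h.exists_mul hDp S n
  set c : G := n * (s : G)⁻¹ with hcdef
  have hPR : (P ⊓ N : Subgroup G) ≤ R := by
    intro x hx
    exact hR ⟨⟨x, hx.2⟩, hS hx, rfl⟩
  have hQR : (Q ⊓ N : Subgroup G) ≤ (c • R : Sylow p G) := by
    intro x hx
    have hx' : (⟨x, hx.2⟩ : N) ∈ n • S := hT hx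
    obtain ⟨y, hy, hyx⟩ := hx'
    have hyx' : (n : G) * y * (n : G)⁻¹ = x := congrArg Subtype.val hyx
    refine ⟨s * y * (s : G)⁻¹, hR ⟨s * y * s⁻¹, mul_mem (mul_mem hs hy) (inv_mem hs), rfl⟩, ?_⟩
    change c * (s * y * (s : G)⁻¹) * c⁻¹ = x
    rw [← hyx', hcdef]
    group
  obtain ⟨hle1, hlt1⟩ := grow P R hDP hPR
  obtain ⟨x, hx, hxP⟩ := ih _ hlt1 P R rfl
  obtain ⟨hle2, hlt2⟩ := grow Q (c • R) hDQ hQR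
  obtain ⟨y, hy, hyQ⟩ := ih _ hlt2 Q (c • R) rfl
  refine ⟨y⁻¹ * c * x, mul_mem (mul_mem (inv_mem ?_) hc) ?_, ?_⟩
  · exact Subgroup.centralizer_le hle2 hy
  · exact Subgroup.centralizer_le hle1 hx
  · rw [mul_smul, mul_smul, hxP, ← hyQ, inv_smul_smul]

/-- A Sylow `p`-subgroup controls its own fusion. -/
lemma NormalizesPTrivially.exists_conj_eq [Finite G] [Fact p.Prime] (h : NormalizesPTrivially p G)
    (P : Sylow p G) {x g : G} (hx : x ∈ P) (hg : g * x * g⁻¹ ∈ P) :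
    ∃ s ∈ P, g * x * g⁻¹ = s * x * s⁻¹ := by
  -- As `x` lies in both Sylow subgroups, `c` centralizes `x`, while `g * c` normalizes `P` and so
  -- acts on `P` as some `s ∈ P`.
  obtain ⟨c, hc, hcP⟩ := h.exists_centralizer_smul_eq P (g⁻¹ • P)
  have hxQ : x ∈ (g⁻¹ • P : Sylow p G) := by
    refine ⟨g * x * g⁻¹, hg, ?_⟩
    change g⁻¹ * (g * x * g⁻¹) * g⁻¹⁻¹ = x
    group
  have hcx := Subgroup.mem_centralizer_iff.1 hc x ⟨hx, hxQ⟩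
  have hgc : g * c ∈ Subgroup.normalizer ((P : Subgroup G) : Set G) := by
    rw [P.coe_coe, ← Sylow.smul_eq_iff_mem_normalizer, mul_smul, hcP, smul_inv_smul]
  obtain ⟨s, hs, hd⟩ := h.exists_mul P.2 (P.subtype Subgroup.le_normalizer) ⟨g * c, hgc⟩
  have hsP : (s : G) ∈ P := hs
  refine ⟨s, hsP, ?_⟩
  have hd' := Subgroup.mem_centralizer_iff.1 hd (s * x * (s : G)⁻¹)
    (mul_mem (mul_mem hsP hx) (inv_mem hsP))
  simp only at hd'
  calc g * x * g⁻¹ = g * (x * c) * c⁻¹ * g⁻¹ := by group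
    _ = (g * c * (s : G)⁻¹) * (s * x * (s : G)⁻¹) * (g * c * (s : G)⁻¹)⁻¹ := by rw [hcx]; group
    _ = s * x * (s : G)⁻¹ := by rw [← hd']; group

/-- Either `p` does not divide the order of `G` or `G` has a nontrivial `p`-quotient. -/
lemma NormalizesPTrivially.exists_normal [Finite G] [Fact p.Prime] (h : NormalizesPTrivially p G)
    (hp : p ∣ Nat.card G) : ∃ K : Subgroup G, ∃ _ : K.Normal, K ≠ ⊤ ∧ IsPGroup p (G ⧸ K) := by
  obtain ⟨P⟩ : Nonempty (Sylow p G) := inferInstance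
  have hnil : Group.IsNilpotent P := P.2.isNilpotent
  have hnt : Nontrivial P := by
    rw [Subgroup.nontrivial_iff_ne_bot]
    exact P.ne_bot_of_dvd_card hp
  have hlt : commutator P < ⊤ := Group.IsSolvable.commutator_lt_top_of_nontrivial P
  -- Fusion control replaces the conjugating element `u` by some `s ∈ P`, so the focal subgroup lies
  -- in `P'`.
  have hfoc : (P : Subgroup G).focalSubgroupOf ≤ commutator P := by
    rw [Subgroup.focalSubgroupOf_eq_closure, Subgroup.closure_le]
    rintro g ⟨x, hx, u, hg⟩
    rw [commutatorElement_def] at hg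
    have hu : u * x⁻¹ * u⁻¹ ∈ P := by
      have := mul_mem (inv_mem hx) g.2
      rw [hg] at this
      change _ ∈ (P : Subgroup G)
      simpa [mul_assoc] using this
    obtain ⟨s, hs, hsu⟩ := h.exists_conj_eq P (inv_mem hx) hu
    have : g = ⁅(⟨x, hx⟩ : P), ⟨s, hs⟩⁆ := by
      apply Subtype.ext
      rw [hg]
      change x * u * x⁻¹ * u⁻¹ = x * s * x⁻¹ * s⁻¹
      simp only [mul_assoc] at hsu ⊢
      rw [hsu]
    rw [this]
    exact Subgroup.commutator_mem_commutator (Subgroup.mem_top _) (Subgroup.mem_top _)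
  refine ⟨(P : Subgroup G).transferFocal.ker, inferInstance, fun htop => ?_, ?_⟩
  · have h1 := Subgroup.ker_transferFocal_inf_eq_focalSubgroup P
    rw [htop, top_inf_eq] at h1
    have h2 : (P : Subgroup G).focalSubgroupOf = ⊤ := by
      rw [Subgroup.focalSubgroupOf_def, ← h1, Subgroup.subgroupOf_self]
    exact hlt.ne (top_le_iff.1 (h2 ▸ hfoc))
  · exact (P.2.to_quotient _).of_equiv
      (Subgroup.transferFocal.quotientKerMulEquivQuotientFocalSubroupOf P).symm

/-- A local criterion for `p`-nilpotency of a group all of whose proper subgroups are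
`p`-nilpotent. -/
lemma NormalizesPTrivially.isPNilpotent [Finite G] [Fact p.Prime] (h : NormalizesPTrivially p G)
    (hprop : ∀ H : Subgroup G, H ≠ ⊤ → IsPNilpotent p H) : IsPNilpotent p G := by
  by_cases hp : p ∣ Nat.card G
  · obtain ⟨K, hK, hne, hquot⟩ := h.exists_normal hp
    exact (hprop K hne).of_normal hquot
  · refine ⟨⊤, inferInstance, ?_, ?_⟩
    · rw [Subgroup.card_top]
      exact ((Fact.out : p.Prime).coprime_iff_not_dvd).2 hp
    · intro g
      have := QuotientGroup.subsingleton_quotient_top (G := G)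
      exact ⟨0, Subsingleton.elim _ _⟩

end Frobenius

/-! ### The involutions and the main theorem -/

/-- An involution generating an `ICΦ`-subgroup `⟨t⟩` of `G` lies outside `[⟨t⟩, G]`. -/
lemma IsICPhiSubgroup.notMem_commutator {G : Type*} [Group G] [Finite G] {t : G} (ht : t ≠ 1)
    (h : IsICPhiSubgroup (Subgroup.zpowers t)) :
    t ∉ ⁅Subgroup.zpowers t, (⊤ : Subgroup G)⁆ := by
  intro hmem
  obtain ⟨x, hx, hxt⟩ := h ⟨Subgroup.mem_zpowers t, hmem⟩
  -- The Frattini subgroup would contain the generator `t`, but it consists of nongenerators.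
  have htop : frattini (Subgroup.zpowers t) = ⊤ := by
    rw [eq_top_iff]
    rintro ⟨_, k, rfl⟩ _
    have : (⟨t ^ k, k, rfl⟩ : Subgroup.zpowers t) = x ^ k := by
      apply Subtype.ext
      simp only [Subgroup.coe_zpow]
      exact congrArg (· ^ k) hxt.symm
    rw [this]
    exact zpow_mem hx k
  have hbot : (⊥ : Subgroup (Subgroup.zpowers t)) = ⊤ :=
    frattini_nongenerating (by rw [htop, bot_sup_eq])
  have h1 : (⟨t, Subgroup.mem_zpowers t⟩ : Subgroup.zpowers t) ∈
      (⊥ : Subgroup (Subgroup.zpowers t)) := hbot ▸ Subgroup.mem_top _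
  rw [Subgroup.mem_bot] at h1
  exact ht (congrArg Subtype.val h1)

lemma notMem_commutator_of_subgroup {G : Type*} [Group G] {H : Subgroup G} {t : H}
    (ht : (t : G) ∉ ⁅Subgroup.zpowers (t : G), (⊤ : Subgroup G)⁆) :
    t ∉ ⁅Subgroup.zpowers t, (⊤ : Subgroup H)⁆ := by
  intro hmem
  apply ht
  have := Subgroup.mem_map_of_mem H.subtype hmem
  rw [Subgroup.map_commutator, MonoidHom.map_zpowers] at this
  exact Subgroup.commutator_mono le_rfl le_top this

/-- The inductive step: a group all of whose proper subgroups are `2`-nilpotent. -/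
lemma isPNilpotent_two_of_proper {G : Type*} [Group G] [Finite G] (hQ : IsQ8Free G)
    (hinv : ∀ t : G, orderOf t = 2 → t ∉ ⁅Subgroup.zpowers t, (⊤ : Subgroup G)⁆)
    (hprop : ∀ H : Subgroup G, H ≠ ⊤ → IsPNilpotent 2 H) : IsPNilpotent 2 G := by
  have : Fact (Nat.Prime 2) := ⟨Nat.prime_two⟩
  refine NormalizesPTrivially.isPNilpotent (fun U hU g hgN hg => ?_) hprop
  by_contra hgC
  have hconj : ∀ u ∈ U, g * u * g⁻¹ ∈ U := fun u hu => (Subgroup.mem_normalizer_iff.1 hgN u).1 hu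
  have htop : U ⊔ Subgroup.zpowers g = ⊤ := by
    by_contra hne
    refine hgC (Subgroup.mem_centralizer_iff.2 fun u hu => Eq.symm ?_)
    exact commute_of_normalizes_of_isPNilpotent_subgroup (hprop _ hne) hU le_sup_left
      (Subgroup.mem_sup_right (Subgroup.mem_zpowers g)) hg hconj hu
  have hUn : U.Normal := by
    rw [← Subgroup.normalizer_eq_top_iff, eq_top_iff, ← htop]
    exact sup_le Subgroup.le_normalizer (by rwa [Subgroup.zpowers_le])
  let σ : MulAut U := MulAut.conjNormal g
  have hσv : ∀ u : U, (σ u : G) = g * u * g⁻¹ := fun u => MulAut.conjNormal_apply g u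
  have hσ : Nat.Coprime 2 (orderOf σ) := hg.coprime_dvd_right (orderOf_map_dvd _ g)
  have hne : σ ≠ 1 := by
    intro h1
    refine hgC (Subgroup.mem_centralizer_iff.2 fun u hu => Eq.symm ?_)
    have := hσv ⟨u, hu⟩
    rw [h1] at this
    exact (mul_inv_eq_iff_eq_mul.1 this.symm)
  have hfix : FixesProperInvariant σ := by
    intro R hR hRtop x hx
    have hRmap : ∀ r ∈ R.map U.subtype, g * r * g⁻¹ ∈ R.map U.subtype := by
      rintro _ ⟨r, hr, rfl⟩
      exact ⟨σ r, hR r hr, hσv r⟩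
    -- If `R⟨g⟩ = G`, each `u ∈ U` is `r * g ^ k` with `g ^ k ∈ U` of odd order, hence trivial, so
    -- `U = R`.
    have hproper : R.map U.subtype ⊔ Subgroup.zpowers g ≠ ⊤ := by
      intro htop'
      have hRn : (R.map U.subtype).Normal := by
        rw [← Subgroup.normalizer_eq_top_iff, eq_top_iff, ← htop']
        refine sup_le Subgroup.le_normalizer ?_
        rw [Subgroup.zpowers_le]
        exact Subgroup.mem_normalizer_fintype hRmap
      apply hRtop
      rw [eq_top_iff]
      intro u _
      have hu : (u : G) ∈ R.map U.subtype ⊔ Subgroup.zpowers g := htop' ▸ Subgroup.mem_top _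
      rw [Subgroup.mem_sup_of_normal_left] at hu
      obtain ⟨_, ⟨r, hr, rfl⟩, _, ⟨k, rfl⟩, hrk⟩ := hu
      simp only [Subgroup.coe_subtype] at hrk
      have hgk : g ^ k = ((r⁻¹ * u : U) : G) := by
        push_cast
        rw [← hrk, inv_mul_cancel_left]
      obtain ⟨l, hl⟩ := hU (r⁻¹ * u)
      have h1 : g ^ k = 1 := by
        refine eq_one_of_pow_of_coprime (p := 2) (k := l) ?_
          (hg.coprime_dvd_right (orderOf_dvd_of_mem_zpowers ⟨k, rfl⟩))
        rw [hgk, ← Subgroup.coe_pow, hl, Subgroup.coe_one]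
      rw [h1, mul_one] at hrk
      rwa [← Subtype.ext hrk]
    have h1 := commute_of_normalizes_of_isPNilpotent_subgroup (hprop _ hproper)
      (hU.to_le (Subgroup.map_subtype_le R)) le_sup_left
      (Subgroup.mem_sup_right (Subgroup.mem_zpowers g)) hg hRmap
      (Subgroup.mem_map_of_mem U.subtype hx)
    apply Subtype.ext
    rw [hσv, mul_inv_eq_iff_eq_mul]
    exact h1
  have hcomm := hfix.commutator_eq_bot hU hσ hne (hQ.of_injective U.subtype U.subtype_injective)
  have hnt : Nontrivial U := by
    by_contra hn
    rw [not_nontrivial_iff_subsingleton] at hn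
    exact hne (by ext x; exact congrArg Subtype.val (Subsingleton.elim _ _))
  obtain ⟨t, ht⟩ : ∃ t : U, orderOf t = 2 := by
    apply exists_prime_orderOf_dvd_card'
    obtain ⟨n, hn⟩ := IsPGroup.iff_card.1 hU
    rw [hn]
    refine dvd_pow_self 2 ?_
    rintro rfl
    exact Finite.one_lt_card.ne' hn
  have htN := hinv t (by rw [Subgroup.orderOf_coe, ht])
  set N := ⁅Subgroup.zpowers (t : G), (⊤ : Subgroup G)⁆ with hN
  have hNn : N.Normal := by
    rw [← Subgroup.normalizer_eq_top_iff, eq_top_iff]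
    exact Subgroup.normalizer_commutator_ge_right _ _
  have hNfix := hfix (N.subgroupOf U)
    (fun x hx => by
      rw [Subgroup.mem_subgroupOf, hσv]
      exact hNn.conj_mem _ hx g)
    (fun h1 => htN (Subgroup.subgroupOf_eq_top.1 h1 t.2))
  have hσt : σ t = t := by
    refine hU.apply_eq_of_apply_inv_mul hσ (hNfix _ ?_)
    rw [Subgroup.mem_subgroupOf]
    have h1 := Subgroup.commutator_mem_commutator (inv_mem (Subgroup.mem_zpowers (t : G)))
      (Subgroup.mem_top g)
    rw [commutatorElement_def, inv_inv] at h1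
    push_cast
    rw [hσv]
    simpa only [mul_assoc] using h1
  have h1 := hfix.mem_commutator hU hσ hne hσt
  rw [hcomm, Subgroup.mem_bot] at h1
  rw [h1, orderOf_one] at ht
  exact absurd ht (by norm_num)

lemma isPNilpotent_two_of_notMem_commutator {G : Type*} [Group G] [Finite G] (hQ : IsQ8Free G)
    (hinv : ∀ t : G, orderOf t = 2 → t ∉ ⁅Subgroup.zpowers t, (⊤ : Subgroup G)⁆) :
    IsPNilpotent 2 G := by
  induction hn : Nat.card G using Nat.strong_induction_on generalizing G with
  | _ n ih =>
  subst hn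
  refine isPNilpotent_two_of_proper hQ hinv fun H hH => ih _ ?_
    (hQ.of_injective H.subtype H.subtype_injective) (fun t ht => ?_) rfl
  · exact lt_of_le_of_ne (Subgroup.card_le_card_group H) fun h1 =>
      hH ((Subgroup.card_eq_iff_eq_top H).1 h1)
  · exact notMem_commutator_of_subgroup (hinv t (by rw [Subgroup.orderOf_coe, ht]))

theorem theorem1p2 {G : Type*} [Group G] [Finite G] (hQ : IsQ8Free G)
    (hIC : ∀ H : Subgroup G, Nat.card H = 2 → IsICPhiSubgroup H) :
    IsPNilpotent 2 G := by
  refine isPNilpotent_two_of_notMem_commutator hQ fun t ht => ?_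
  refine (hIC (Subgroup.zpowers t) (by rw [Nat.card_zpowers, ht])).notMem_commutator ?_
  rintro rfl
  simp at ht
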